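/- Let $T$ be a Hausdorff topological space with its Borel $\sigma$-algebra $\mathcal B$. A set is symmetrizable if it is the intersection of an open set and a closed set. A function $f:T\to\mathbb R$ is symmetrizable if for every $\varepsilon>0$ there is a finite cover of $T$ by symmetrizable sets $K$ with $\sup\{|f(s)-f(t)| : s,t\in K\}<\varepsilon$; let $S(T)$ be the space of all symmetrizable functions. A bounded Radon measure on $T$ is a bounded signed ($\sigma$-additive, real-valued) measure $\mu$ on $\mathcal B$ such that for all $B\in\mathcal B$ and $\varepsilon>0$ there is a compact set $C\subseteq B$ with $|\mu(B)-\mu(C)|<\varepsilon$; $|\mu|$ denotes its total variation, and $RM_b(T)$ the set of all bounded Radon measures. The $S(T)$-weak topology on $RM_b(T)$ is the coarsest topology for which $\mu\mapsto\int f\,d\mu$ is continuous for every $f\in S(T)$. **Theorem.** Let $M\subseteq RM_b(T)$ be such that 1. for every open $G\subseteq T$ and every $\varepsilon>0$ there is a compact set $C\subseteq G$ such that $|\mu|(G\setminus C)<\varepsilon$ for all $\mu\in M$; 2. $\sup\{|\mu|(T):\mu\in M\}<\infty$. Then the closure of $M$ in the $S(T)$-weak topology of $RM_b(T)$, with the induced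 topology, is compact (that is, Hausdorff and such that every open cover has a finite subcover). -/

import Mathlib

open MeasureTheory Set
open scoped ENNReal

section RadonWeak

variable {T : Type*} [TopologicalSpace T]

/-- A symmetrizable set: the intersection of an open set and a closed set. -/
def IsSymmetrizableSet (K : Set T) : Prop :=
  ∃ G F : Set T, IsOpen G ∧ IsClosed F ∧ K = G ∩ F

/-- The oscillation `sup {|f s - f t| : s, t ∈ K}`, as an extended nonnegative real
(so it is `∞` when `f` is unbounded on `K`, and `0` when `K` is empty). -/
noncomputable def oscillationOver {X : Type*} (f : X → ℝ) (K : Set X) : ℝ≥0∞ :=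
  ⨆ s ∈ K, ⨆ t ∈ K, ENNReal.ofReal |f s - f t|

/-- `f` is symmetrizable (metasemicontinuous): for every `ε > 0` there is a finite cover of the
space by symmetrizable sets on each of which the oscillation of `f` is less than `ε`. -/
def IsSymmetrizableFun (f : T → ℝ) : Prop :=
  ∀ ε : ℝ, 0 < ε → ∃ 𝒦 : Set (Set T), 𝒦.Finite ∧ ⋃₀ 𝒦 = univ ∧
    ∀ K ∈ 𝒦, IsSymmetrizableSet K ∧ oscillationOver f K < ENNReal.ofReal ε

variable (T) in
/-- The space `S(T)` of all symmetrizable functions. -/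
def SymmetrizableFun : Type _ := {f : T → ℝ // IsSymmetrizableFun f}

variable (T) in
/-- Bounded Radon measures: finite signed (countably additive, real-valued) measures on the Borel
`σ`-algebra that are inner compactly regular. -/
structure BoundedRadonMeasure [MeasurableSpace T] where
  /-- the underlying signed measure -/
  toSignedMeasure : SignedMeasure T
  /-- inner compact regularity -/
  regular : ∀ B : Set T, MeasurableSet B → ∀ ε : ℝ, 0 < ε →
    ∃ C : Set T, IsCompact C ∧ C ⊆ B ∧ |toSignedMeasure B - toSignedMeasure C| < ε

namespace BoundedRadonMeasure

variable [MeasurableSpace T]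

/-- The total variation `|μ|`, a positive finite measure. -/
noncomputable def var (μ : BoundedRadonMeasure T) : Measure T :=
  μ.toSignedMeasure.totalVariation

/-- The integral of `f` with respect to the signed measure `μ`: the difference of the integrals
with respect to the positive and the negative part of the Jordan decomposition of `μ`. -/
noncomputable def integral (μ : BoundedRadonMeasure T) (f : T → ℝ) : ℝ :=
  (∫ t, f t ∂μ.toSignedMeasure.toJordanDecomposition.posPart) -
    ∫ t, f t ∂μ.toSignedMeasure.toJordanDecomposition.negPart

/-- The weak topology on bounded Radon measures with respect to `S(T)`: the coarsest topology for
which `μ ↦ ∫ f dμ` is continuous for every symmetrizable `f`. -/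
noncomputable instance weakTopology : TopologicalSpace (BoundedRadonMeasure T) :=
  TopologicalSpace.induced
    (fun (μ : BoundedRadonMeasure T) (f : SymmetrizableFun T) => μ.integral f.1) inferInstance

/-- Locally-uniform tightness of the total variations of a set of bounded Radon measures. -/
def LocallyUniformlyTightVar (M : Set (BoundedRadonMeasure T)) : Prop :=
  ∀ G : Set T, IsOpen G → ∀ ε : ℝ, 0 < ε →
    ∃ C : Set T, IsCompact C ∧ C ⊆ G ∧ ∀ μ ∈ M, μ.var (G \ C) < ENNReal.ofReal ε

/-- Uniform boundedness of the total masses: `sup {|μ|(T) : μ ∈ M}` is finite. -/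
def UniformlyBoundedVar (M : Set (BoundedRadonMeasure T)) : Prop :=
  (⨆ μ ∈ M, μ.var univ) < ∞

end BoundedRadonMeasure

end RadonWeak

/-! Integration embeds the bounded Radon measures into the product of copies of ℝ indexed by `S(T)`.
Bounded variation puts the image of `M` in a product of compact intervals, so by Tychonoff its
closure is compact; the point is that this closure consists of Radon measures
(`closure_image_eval_subset_range`). A limit point is a limit along an ultrafilter on `M`. The
positive parts have a setwise limit that is only finitely additive, but on compact sets it is a
content, and by tightness the Radon measure it induces agrees with the limit on every open set
(`exists_radon_tendsto_isOpen`). Symmetrizable functions are uniform limits of combinations of open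
indicators, so their integrals converge too. The same holds for the negative parts, and the
difference of the two limit measures represents the limit point. -/

open Filter Topology TopologicalSpace

/-! ### Ultrafilter limits of tight families of positive measures. -/

section LimitMeasure

variable {T : Type*} [MeasurableSpace T]

/-- The setwise limit of a family of measures along an ultrafilter. -/
noncomputable def ultraLimit {ι : Type*} (u : Ultrafilter ι) (m : ι → Measure T) (A : Set T) :
    ℝ≥0∞ :=
  (u.map fun i => m i A).lim

theorem tendsto_ultraLimit {ι : Type*} (u : Ultrafilter ι) (m : ι → Measure T) (A : Set T) :
    Tendsto (fun i => m i A) u (𝓝 (ultraLimit u m A)) :=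
  (u.map fun i => m i A).le_nhds_lim

theorem ultraLimit_mono {ι : Type*} (u : Ultrafilter ι) (m : ι → Measure T) {A B : Set T}
    (h : A ⊆ B) : ultraLimit u m A ≤ ultraLimit u m B :=
  le_of_tendsto_of_tendsto' (tendsto_ultraLimit u m A) (tendsto_ultraLimit u m B)
    fun _ => measure_mono h

theorem ultraLimit_union_le {ι : Type*} (u : Ultrafilter ι) (m : ι → Measure T) (A B : Set T) :
    ultraLimit u m (A ∪ B) ≤ ultraLimit u m A + ultraLimit u m B :=
  le_of_tendsto_of_tendsto' (tendsto_ultraLimit u m _)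
    ((tendsto_ultraLimit u m A).add (tendsto_ultraLimit u m B)) fun _ => measure_union_le A B

theorem ultraLimit_union {ι : Type*} (u : Ultrafilter ι) (m : ι → Measure T) {A B : Set T}
    (hAB : Disjoint A B) (hB : MeasurableSet B) :
    ultraLimit u m (A ∪ B) = ultraLimit u m A + ultraLimit u m B := by
  refine tendsto_nhds_unique (tendsto_ultraLimit u m _) ?_
  simp_rw [measure_union hAB hB]
  exact (tendsto_ultraLimit u m A).add (tendsto_ultraLimit u m B)

theorem ultraLimit_lt_top {ι : Type*} {u : Ultrafilter ι} {m : ι → Measure T} {c : ℝ≥0∞}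
    (hc : c < ∞) (hm : ∀ᶠ i in (u : Filter ι), m i univ ≤ c) (A : Set T) :
    ultraLimit u m A < ∞ :=
  (le_of_tendsto (tendsto_ultraLimit u m A)
    (hm.mono fun _ hi => (measure_mono (subset_univ A)).trans hi)).trans_lt hc

variable [TopologicalSpace T]

/-- The restriction to compact sets of the setwise limit of a bounded family of measures. -/
noncomputable def ultraContent [BorelSpace T] {ι : Type*} (u : Ultrafilter ι)
    (m : ι → Measure T) {c : ℝ≥0∞} (hc : c < ∞) (hm : ∀ᶠ i in (u : Filter ι), m i univ ≤ c) :
    Content T where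
  toFun K := (ultraLimit u m K).toNNReal
  mono' _ _ h := ENNReal.toNNReal_mono (ultraLimit_lt_top hc hm _).ne (ultraLimit_mono u m h)
  sup_disjoint' K₁ K₂ h _ h₂ := by
    rw [Compacts.coe_sup, ultraLimit_union u m h h₂.measurableSet,
      ENNReal.toNNReal_add (ultraLimit_lt_top hc hm _).ne (ultraLimit_lt_top hc hm _).ne]
  sup_le' K₁ K₂ := by
    rw [Compacts.coe_sup,
      ← ENNReal.toNNReal_add (ultraLimit_lt_top hc hm _).ne (ultraLimit_lt_top hc hm _).ne]
    exact ENNReal.toNNReal_mono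
      (ENNReal.add_ne_top.2 ⟨(ultraLimit_lt_top hc hm _).ne, (ultraLimit_lt_top hc hm _).ne⟩)
      (ultraLimit_union_le u m _ _)

theorem ultraContent_apply [BorelSpace T] {ι : Type*} (u : Ultrafilter ι)
    (m : ι → Measure T) {c : ℝ≥0∞} (hc : c < ∞) (hm : ∀ᶠ i in (u : Filter ι), m i univ ≤ c)
    (K : Compacts T) : ultraContent u m hc hm K = ultraLimit u m K :=
  ENNReal.coe_toNNReal (ultraLimit_lt_top hc hm _).ne

/-- A bounded family of measures that is uniformly tight on every open set converges, along an
ultrafilter, to a finite Radon measure on all open sets. -/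
theorem exists_radon_tendsto_isOpen [T2Space T] [BorelSpace T] {ι : Type*} (u : Ultrafilter ι)
    (m : ι → Measure T) {c : ℝ≥0∞} (hc : c < ∞) (hm : ∀ᶠ i in (u : Filter ι), m i univ ≤ c)
    (ht : ∀ G : Set T, IsOpen G → ∀ ε : ℝ≥0∞, 0 < ε →
      ∃ C : Set T, IsCompact C ∧ C ⊆ G ∧ ∀ᶠ i in (u : Filter ι), m i (G \ C) ≤ ε) :
    ∃ ν : Measure T, IsFiniteMeasure ν ∧
      (∀ B : Set T, MeasurableSet B → ∀ ε : ℝ≥0∞, 0 < ε →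
        ∃ C : Set T, IsCompact C ∧ C ⊆ B ∧ ν (B \ C) < ε) ∧
      ∀ G : Set T, IsOpen G → Tendsto (fun i => m i G) u (𝓝 (ν G)) := by
  set ν := (ultraContent u m hc hm).measure with hν
  have hopen : ∀ G : Set T, IsOpen G → ν G = ultraLimit u m G := by
    intro G hG
    rw [hν, Content.measure_apply _ hG.measurableSet, Content.outerMeasure_of_isOpen _ _ hG]
    apply le_antisymm
    · refine iSup₂_le fun K hK => ?_
      rw [ultraContent_apply]
      exact ultraLimit_mono u m hK
    -- Tightness on `G` prevents loss of mass in passing from the finitely additive limit to `ν`.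
    · refine ENNReal.le_of_forall_pos_le_add fun ε hε _ => ?_
      obtain ⟨C, hC, hCG, hCε⟩ := ht G hG ε (by exact_mod_cast hε)
      have h1 : ultraLimit u m (G \ C) ≤ ε := le_of_tendsto (tendsto_ultraLimit u m _) hCε
      have h2 := Content.le_innerContent (ultraContent u m hc hm) ⟨C, hC⟩ ⟨G, hG⟩ hCG
      rw [ultraContent_apply] at h2
      calc ultraLimit u m G = ultraLimit u m (C ∪ G \ C) := by rw [union_sdiff_cancel hCG]
        _ ≤ ultraLimit u m C + ultraLimit u m (G \ C) := ultraLimit_union_le u m _ _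
        _ ≤ _ := add_le_add h2 h1
  have hfin : IsFiniteMeasure ν :=
    ⟨by rw [hopen _ isOpen_univ]; exact ultraLimit_lt_top hc hm _⟩
  refine ⟨ν, hfin, fun B hB ε hε => ?_, fun G hG => ?_⟩
  · have hε2 : 0 < ε / 2 := ENNReal.half_pos hε.ne'
    -- Outer regularity at `Bᶜ` gives a closed set `Uᶜ` inside `B`; cutting it with a compact set
    -- carrying nearly all the mass makes it compact.
    obtain ⟨U, hBU, hU, -, hUε⟩ := hB.compl.exists_isOpen_sdiff_lt (measure_ne_top ν _) hε2.ne'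
    obtain ⟨C, hC, -, hCε⟩ := ht univ isOpen_univ (ε / 2) hε2
    have h1 : ν Cᶜ ≤ ε / 2 := by
      rw [hopen _ hC.isClosed.isOpen_compl]
      refine le_of_tendsto (tendsto_ultraLimit u m _) ?_
      simpa only [compl_eq_univ_sdiff] using hCε
    refine ⟨C ∩ Uᶜ, hC.inter_right hU.isClosed_compl, fun x hx => ?_, ?_⟩
    · by_contra h
      exact hx.2 (hBU h)
    · calc ν (B \ (C ∩ Uᶜ)) ≤ ν (Cᶜ ∪ U \ Bᶜ) := by
            refine measure_mono fun x hx => ?_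
            by_cases hxC : x ∈ C
            · refine Or.inr ⟨?_, fun h => h hx.1⟩
              by_contra h
              exact hx.2 ⟨hxC, h⟩
            · exact Or.inl hxC
        _ ≤ ν Cᶜ + ν (U \ Bᶜ) := measure_union_le _ _
        _ < ε / 2 + ε / 2 :=
            ENNReal.add_lt_add_of_le_of_lt (measure_ne_top ν _) h1 hUε
        _ = ε := ENNReal.add_halves ε
  · rw [hopen G hG]
    exact tendsto_ultraLimit u m G

end LimitMeasure

theorem abs_integral_sub_integral_le {X : Type*} [MeasurableSpace X] {μ : Measure X} [IsFiniteMeasure μ] {f g : X → ℝ}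
    {ε c : ℝ} (hf : Integrable f μ) (hg : Integrable g μ) (hε : 0 ≤ ε) (hfg : ∀ x, |f x - g x| ≤ ε)
    (hc : μ.real univ ≤ c) : |∫ x, f x ∂μ - ∫ x, g x ∂μ| ≤ ε * c := by
  rw [← integral_sub hf hg]
  exact (norm_integral_le_of_norm_le_const (f := fun x => f x - g x) (ae_of_all _ hfg)).trans
    (mul_le_mul_of_nonneg_left hc hε)

/-! ### Approximation of symmetrizable functions by open indicators. -/

section Symmetrizable

variable {T : Type*} [TopologicalSpace T]

theorem abs_sub_lt_of_oscillationOver_lt {X : Type*} {f : X → ℝ} {K : Set X} {ε : ℝ}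
    (hε : 0 < ε) (h : oscillationOver f K < ENNReal.ofReal ε) {s t : X} (hs : s ∈ K)
    (ht : t ∈ K) : |f s - f t| < ε := by
  have h1 : ENNReal.ofReal |f s - f t| ≤ oscillationOver f K :=
    le_iSup₂_of_le s hs (le_iSup₂_of_le t ht le_rfl)
  exact (ENNReal.ofReal_lt_ofReal_iff hε).1 (h1.trans_lt h)

theorem isSymmetrizableFun_indicator {G : Set T} (hG : IsOpen G) :
    IsSymmetrizableFun (G.indicator (1 : T → ℝ)) := by
  intro ε hε
  refine ⟨{G, Gᶜ}, by simp, by simp, ?_⟩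
  have hosc : ∀ K : Set T, (∀ s ∈ K, ∀ t ∈ K,
      G.indicator (1 : T → ℝ) s = G.indicator (1 : T → ℝ) t) →
      oscillationOver (G.indicator (1 : T → ℝ)) K < ENNReal.ofReal ε := by
    intro K hK
    refine lt_of_le_of_lt ?_ (ENNReal.ofReal_pos.2 hε)
    refine iSup₂_le fun s hs => iSup₂_le fun t ht => ?_
    simp [hK s hs t ht]
  rintro K (rfl | rfl)
  · exact ⟨⟨K, univ, hG, isClosed_univ, by simp⟩, hosc _ fun s hs t ht => by simp [hs, ht]⟩
  · exact ⟨⟨univ, Gᶜ, isOpen_univ, hG.isClosed_compl, by simp⟩, hosc _ fun s hs t ht => by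
      rw [indicator_of_notMem hs, indicator_of_notMem ht]⟩

variable (T) in
/-- The multiplicative monoid of indicator functions of open sets. -/
noncomputable def openIndicators : Submonoid (T → ℝ) where
  carrier := {g | ∃ G : Set T, IsOpen G ∧ g = G.indicator 1}
  one_mem' := ⟨univ, isOpen_univ, by simp⟩
  mul_mem' := by
    rintro _ _ ⟨G, hG, rfl⟩ ⟨H, hH, rfl⟩
    exact ⟨G ∩ H, hG.inter hH, by rw [inter_indicator_one]⟩

/-- Open sets are stable under intersection, so products create nothing new: approximants can be
built in the algebra while limits are checked only on the linear span. -/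
theorem adjoin_openIndicators_eq_span :
    Subalgebra.toSubmodule (Algebra.adjoin ℝ (openIndicators T : Set (T → ℝ))) =
      Submodule.span ℝ (openIndicators T : Set (T → ℝ)) := by
  rw [Algebra.adjoin_eq_span, Submonoid.closure_eq]

theorem indicator_mem_adjoin_of_isSymmetrizableSet {K : Set T} (hK : IsSymmetrizableSet K) :
    K.indicator 1 ∈ Algebra.adjoin ℝ (openIndicators T : Set (T → ℝ)) := by
  obtain ⟨G, F, hG, hF, rfl⟩ := hK
  have h : (G ∩ F).indicator (1 : T → ℝ) = G.indicator 1 * (1 - Fᶜ.indicator 1) := by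
    ext x
    by_cases h1 : x ∈ G <;> by_cases h2 : x ∈ F <;> simp [h1, h2]
  rw [h]
  exact mul_mem (Algebra.subset_adjoin ⟨G, hG, rfl⟩)
    (sub_mem (one_mem _) (Algebra.subset_adjoin ⟨Fᶜ, hF.isOpen_compl, rfl⟩))

/-- Symmetrizable functions are uniformly approximable by linear combinations of indicator
functions of open sets. -/
theorem IsSymmetrizableFun.exists_span_approx {f : T → ℝ} (hf : IsSymmetrizableFun f) {ε : ℝ}
    (hε : 0 < ε) :
    ∃ g ∈ Submodule.span ℝ (openIndicators T : Set (T → ℝ)), ∀ x, |f x - g x| ≤ ε := by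
  obtain ⟨𝒦, hfin, hcov, h𝒦⟩ := hf ε hε
  suffices h : ∃ g ∈ Algebra.adjoin ℝ (openIndicators T : Set (T → ℝ)),
      ∀ x ∈ ⋃₀ 𝒦, |f x - g x| ≤ ε by
    obtain ⟨g, hg, hfg⟩ := h
    rw [← adjoin_openIndicators_eq_span]
    exact ⟨g, hg, fun x => hfg x (hcov ▸ mem_univ x)⟩
  clear hcov
  induction 𝒦, hfin using Set.Finite.induction_on with
  | empty => exact ⟨0, zero_mem _, by simp⟩
  | @insert K 𝒦 _ _ ih =>
    obtain ⟨g, hg, hfg⟩ := ih fun L hL => h𝒦 L (mem_insert_of_mem K hL)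
    obtain ⟨hK, hosc⟩ := h𝒦 K (mem_insert K 𝒦)
    have hKi := indicator_mem_adjoin_of_isSymmetrizableSet hK
    rcases K.eq_empty_or_nonempty with rfl | ⟨t, ht⟩
    · exact ⟨g, hg, by simpa using hfg⟩
    -- Overwrite `g` on `K` by the constant `f t`; the cover need not be disjoint.
    refine ⟨g * (1 - K.indicator 1) + f t • K.indicator 1,
      add_mem (mul_mem hg (sub_mem (one_mem _) hKi)) (Subalgebra.smul_mem _ hKi _), ?_⟩
    intro x hx
    by_cases hxK : x ∈ K
    · simpa [hxK] using (abs_sub_lt_of_oscillationOver_lt hε hosc hxK ht).le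
    · rw [sUnion_insert] at hx
      simpa [hxK] using hfg x (hx.resolve_left hxK)

variable [MeasurableSpace T] [BorelSpace T]

theorem measurable_and_bounded_of_mem_span {g : T → ℝ}
    (hg : g ∈ Submodule.span ℝ (openIndicators T : Set (T → ℝ))) :
    Measurable g ∧ ∃ c : ℝ, ∀ x, |g x| ≤ c := by
  induction hg using Submodule.span_induction with
  | mem g hg =>
    obtain ⟨G, hG, rfl⟩ := hg
    refine ⟨measurable_one.indicator hG.measurableSet, 1, fun x => ?_⟩
    by_cases h : x ∈ G <;> simp [h]
  | zero => exact ⟨measurable_zero, 0, by simp⟩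
  | add g h _ _ ihg ihh =>
    obtain ⟨mg, c, hc⟩ := ihg
    obtain ⟨mh, d, hd⟩ := ihh
    exact ⟨mg.add mh, c + d, fun x => (abs_add_le _ _).trans (add_le_add (hc x) (hd x))⟩
  | smul a g _ ih =>
    obtain ⟨mg, c, hc⟩ := ih
    refine ⟨mg.const_smul a, |a| * c, fun x => ?_⟩
    rw [Pi.smul_apply, smul_eq_mul, abs_mul]
    exact mul_le_mul_of_nonneg_left (hc x) (abs_nonneg a)

theorem integrable_of_mem_span {g : T → ℝ}
    (hg : g ∈ Submodule.span ℝ (openIndicators T : Set (T → ℝ))) (μ : Measure T)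
    [IsFiniteMeasure μ] : Integrable g μ := by
  obtain ⟨mg, c, hc⟩ := measurable_and_bounded_of_mem_span hg
  exact Integrable.of_bound mg.aestronglyMeasurable c (ae_of_all _ hc)

theorem IsSymmetrizableFun.measurable {f : T → ℝ} (hf : IsSymmetrizableFun f) :
    Measurable f := by
  choose g hg hfg using fun n : ℕ =>
    hf.exists_span_approx (Nat.one_div_pos_of_nat (α := ℝ) (n := n))
  refine measurable_of_tendsto_metrizable (fun n => (measurable_and_bounded_of_mem_span (hg n)).1)
    (tendsto_pi_nhds.2 fun x => ?_)
  rw [tendsto_iff_dist_tendsto_zero]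
  refine squeeze_zero (fun _ => dist_nonneg) (fun n => ?_) tendsto_one_div_add_atTop_nhds_zero_nat
  rw [dist_comm]
  exact hfg n x

theorem IsSymmetrizableFun.integrable {f : T → ℝ} (hf : IsSymmetrizableFun f) (μ : Measure T)
    [IsFiniteMeasure μ] : Integrable f μ := by
  obtain ⟨g, hg, hfg⟩ := hf.exists_span_approx one_pos
  obtain ⟨-, c, hc⟩ := measurable_and_bounded_of_mem_span hg
  refine Integrable.of_bound hf.measurable.aestronglyMeasurable (1 + c) (ae_of_all _ fun x => ?_)
  calc ‖f x‖ = |(f x - g x) + g x| := by rw [sub_add_cancel, Real.norm_eq_abs]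
    _ ≤ |f x - g x| + |g x| := abs_add_le _ _
    _ ≤ 1 + c := add_le_add (hfg x) (hc x)

theorem tendsto_integral_of_mem_span {ι : Type*} {l : Filter ι} {m : ι → Measure T}
    [∀ i, IsFiniteMeasure (m i)] {ν : Measure T} [IsFiniteMeasure ν]
    (h : ∀ G : Set T, IsOpen G → Tendsto (fun i => m i G) l (𝓝 (ν G))) {g : T → ℝ}
    (hg : g ∈ Submodule.span ℝ (openIndicators T : Set (T → ℝ))) :
    Tendsto (fun i => ∫ x, g x ∂m i) l (𝓝 (∫ x, g x ∂ν)) := by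
  induction hg using Submodule.span_induction with
  | mem g hg =>
    obtain ⟨G, hG, rfl⟩ := hg
    simp_rw [integral_indicator_one hG.measurableSet]
    exact (ENNReal.tendsto_toReal (measure_ne_top ν G)).comp (h G hG)
  | zero => simp [tendsto_const_nhds]
  | add g k hg hk ihg ihk =>
    simp_rw [Pi.add_apply]
    rw [integral_add (integrable_of_mem_span hg ν) (integrable_of_mem_span hk ν)]
    simp_rw [fun i => integral_add (integrable_of_mem_span hg (m i))
      (integrable_of_mem_span hk (m i))]
    exact ihg.add ihk
  | smul a g _ ih =>
    simp_rw [Pi.smul_apply, integral_smul]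
    exact ih.const_smul a

/-- Convergence on open sets implies convergence of the integrals of symmetrizable functions. -/
theorem IsSymmetrizableFun.tendsto_integral {ι : Type*} {l : Filter ι} {m : ι → Measure T}
    [∀ i, IsFiniteMeasure (m i)] {ν : Measure T} [IsFiniteMeasure ν]
    (h : ∀ G : Set T, IsOpen G → Tendsto (fun i => m i G) l (𝓝 (ν G))) {f : T → ℝ}
    (hf : IsSymmetrizableFun f) :
    Tendsto (fun i => ∫ x, f x ∂m i) l (𝓝 (∫ x, f x ∂ν)) := by
  -- The extra 1 makes `c` eventually bound the masses of the `m i` as well.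
  set c : ℝ := ν.real univ + 1
  have hc0 : 0 < c := by positivity
  have hmass : ∀ᶠ i in l, (m i).real univ < c :=
    ((ENNReal.tendsto_toReal (measure_ne_top ν univ)).comp (h univ isOpen_univ)).eventually
      (gt_mem_nhds (lt_add_one _))
  rw [Metric.tendsto_nhds]
  intro ε hε
  have hδ : 0 < ε / (3 * c) := by positivity
  obtain ⟨g, hg, hfg⟩ := hf.exists_span_approx hδ
  have hδc : ε / (3 * c) * c = ε / 3 := by field_simp
  filter_upwards [hmass, (Metric.tendsto_nhds.1 (tendsto_integral_of_mem_span h hg)) (ε / 3)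
    (by positivity)] with i hi hgi
  have h1 := abs_integral_sub_integral_le (hf.integrable (m i)) (integrable_of_mem_span hg (m i))
    hδ.le hfg hi.le
  have h2 := abs_integral_sub_integral_le (hf.integrable ν) (integrable_of_mem_span hg ν)
    hδ.le hfg (show ν.real univ ≤ c by linarith)
  rw [hδc] at h1 h2
  rw [Real.dist_eq] at hgi ⊢
  rw [abs_lt] at hgi ⊢
  rw [abs_le] at h1 h2
  constructor <;> linarith [h1.1, h1.2, h2.1, h2.2, hgi.1, hgi.2]

end Symmetrizable

/-! ### The embedding into the product space and its closed image. -/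

namespace BoundedRadonMeasure

variable {T : Type*} [TopologicalSpace T] [MeasurableSpace T]

/-- The positive part of a bounded Radon measure. -/
noncomputable def pos (μ : BoundedRadonMeasure T) : Measure T :=
  μ.toSignedMeasure.toJordanDecomposition.posPart

/-- The negative part of a bounded Radon measure. -/
noncomputable def neg (μ : BoundedRadonMeasure T) : Measure T :=
  μ.toSignedMeasure.toJordanDecomposition.negPart

instance (μ : BoundedRadonMeasure T) : IsFiniteMeasure μ.pos :=
  μ.toSignedMeasure.toJordanDecomposition.posPart_finite

instance (μ : BoundedRadonMeasure T) : IsFiniteMeasure μ.neg :=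
  μ.toSignedMeasure.toJordanDecomposition.negPart_finite

theorem pos_le_var (μ : BoundedRadonMeasure T) (A : Set T) : μ.pos A ≤ μ.var A :=
  Measure.le_add_right le_rfl A

theorem neg_le_var (μ : BoundedRadonMeasure T) (A : Set T) : μ.neg A ≤ μ.var A :=
  Measure.le_add_left le_rfl A

theorem toSignedMeasure_eq_pos_sub_neg (μ : BoundedRadonMeasure T) :
    μ.toSignedMeasure = μ.pos.toSignedMeasure - μ.neg.toSignedMeasure :=
  μ.toSignedMeasure.toSignedMeasure_toJordanDecomposition.symm

theorem integral_eq_pos_sub_neg (μ : BoundedRadonMeasure T) (f : T → ℝ) :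
    μ.integral f = ∫ t, f t ∂μ.pos - ∫ t, f t ∂μ.neg :=
  rfl

/-- The embedding of the bounded Radon measures into the product space `S(T) → ℝ`. -/
noncomputable def eval (μ : BoundedRadonMeasure T) (f : SymmetrizableFun T) : ℝ :=
  μ.integral f.1

theorem isInducing_eval : IsInducing (eval : BoundedRadonMeasure T → SymmetrizableFun T → ℝ) :=
  ⟨rfl⟩

theorem toSignedMeasure_injective :
    Function.Injective (toSignedMeasure : BoundedRadonMeasure T → SignedMeasure T) := by
  rintro ⟨μ, _⟩ ⟨ν, _⟩ rfl
  rfl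

variable [BorelSpace T]

/-- Open indicators are symmetrizable and open sets form a generating π-system. Moving negative
parts across the equation leaves finite positive measures to compare. -/
theorem eval_injective :
    Function.Injective (eval : BoundedRadonMeasure T → SymmetrizableFun T → ℝ) := by
  intro μ ν h
  have hG : ∀ G : Set T, IsOpen G → (μ.pos + ν.neg) G = (ν.pos + μ.neg) G := by
    intro G hG
    have h1 : μ.integral (G.indicator 1) = ν.integral (G.indicator 1) :=
      congrFun h ⟨_, isSymmetrizableFun_indicator hG⟩
    simp only [integral_eq_pos_sub_neg, integral_indicator_one hG.measurableSet] at h1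
    rw [← measureReal_eq_measureReal_iff, measureReal_add_apply, measureReal_add_apply]
    linarith
  have hadd : μ.pos + ν.neg = ν.pos + μ.neg :=
    ext_of_generate_finite _ BorelSpace.measurable_eq isPiSystem_isOpen hG (hG _ isOpen_univ)
  apply toSignedMeasure_injective
  rw [toSignedMeasure_eq_pos_sub_neg, toSignedMeasure_eq_pos_sub_neg, sub_eq_sub_iff_add_eq_add,
    ← Measure.toSignedMeasure_add, ← Measure.toSignedMeasure_add,
    Measure.toSignedMeasure_eq_toSignedMeasure_iff, hadd]

instance : T2Space (BoundedRadonMeasure T) :=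
  T2Space.of_injective_continuous eval_injective isInducing_eval.continuous

/-- The difference of two finite compactly inner regular measures, as a bounded Radon measure. -/
noncomputable def ofSub [T2Space T] (ν₁ ν₂ : Measure T) [IsFiniteMeasure ν₁] [IsFiniteMeasure ν₂]
    (h₁ : ∀ B : Set T, MeasurableSet B → ∀ ε : ℝ≥0∞, 0 < ε →
      ∃ C : Set T, IsCompact C ∧ C ⊆ B ∧ ν₁ (B \ C) < ε)
    (h₂ : ∀ B : Set T, MeasurableSet B → ∀ ε : ℝ≥0∞, 0 < ε →
      ∃ C : Set T, IsCompact C ∧ C ⊆ B ∧ ν₂ (B \ C) < ε) : BoundedRadonMeasure T where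
  toSignedMeasure := ν₁.toSignedMeasure - ν₂.toSignedMeasure
  regular B hB ε hε := by
    obtain ⟨C, hC, hCB, hCε⟩ := h₁ B hB _ (ENNReal.ofReal_pos.2 hε)
    obtain ⟨D, hD, hDB, hDε⟩ := h₂ B hB _ (ENNReal.ofReal_pos.2 hε)
    -- On `C ∪ D` both defects lie in `[0, ε)`, so their difference is below `ε` in absolute value.
    have hsub : C ∪ D ⊆ B := union_subset hCB hDB
    have hm : MeasurableSet (C ∪ D) := (hC.union hD).measurableSet
    have key : ∀ (ν : Measure T) [IsFiniteMeasure ν], ∀ E ⊆ C ∪ D, ν (B \ E) < ENNReal.ofReal ε →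
        ν.real B - ν.real (C ∪ D) < ε := by
      intro ν _ E hE hν
      rw [← measureReal_sdiff hsub hm]
      exact (ENNReal.lt_ofReal_iff_toReal_lt (measure_ne_top ν _)).1
        ((measure_mono (sdiff_subset_sdiff_right hE)).trans_lt hν)
    have k1 := key ν₁ C subset_union_left hCε
    have k2 := key ν₂ D subset_union_right hDε
    have m1 : ν₁.real (C ∪ D) ≤ ν₁.real B := measureReal_mono hsub
    have m2 : ν₂.real (C ∪ D) ≤ ν₂.real B := measureReal_mono hsub
    refine ⟨C ∪ D, hC.union hD, hsub, ?_⟩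
    rw [Measure.toSignedMeasure_sub_apply hB, Measure.toSignedMeasure_sub_apply hm, abs_lt]
    constructor <;> linarith

/-- Needed because limits of positive and negative parts may fail to be mutually singular, hence
need not be the Jordan decomposition of their difference. -/
theorem integral_eq_of_toSignedMeasure_eq_sub {μ : BoundedRadonMeasure T} {ν₁ ν₂ : Measure T}
    [IsFiniteMeasure ν₁] [IsFiniteMeasure ν₂]
    (h : μ.toSignedMeasure = ν₁.toSignedMeasure - ν₂.toSignedMeasure) {f : T → ℝ}
    (hf : IsSymmetrizableFun f) :
    μ.integral f = ∫ t, f t ∂ν₁ - ∫ t, f t ∂ν₂ := by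
  rw [toSignedMeasure_eq_pos_sub_neg, sub_eq_sub_iff_add_eq_add, ← Measure.toSignedMeasure_add,
    ← Measure.toSignedMeasure_add, Measure.toSignedMeasure_eq_toSignedMeasure_iff] at h
  have hint := congrArg (fun m : Measure T => ∫ t, f t ∂m) h
  simp only [integral_add_measure (hf.integrable _) (hf.integrable _)] at hint
  rw [integral_eq_pos_sub_neg]
  linarith

theorem closure_image_eval_subset_range [T2Space T] {M : Set (BoundedRadonMeasure T)}
    (hα : LocallyUniformlyTightVar M) (hβ : UniformlyBoundedVar M) :
    closure (eval '' M) ⊆ range eval := by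
  intro L hL
  obtain ⟨w, hMw, hw⟩ := mem_closure_iff_ultrafilter.1 hL
  -- Pull the ultrafilter back from the product space to one on measures that contains `M`.
  let u : Ultrafilter (BoundedRadonMeasure T) := Ultrafilter.ofComapInfPrincipal hMw
  have hMu : ∀ᶠ μ in (u : Filter (BoundedRadonMeasure T)), μ ∈ M :=
    Ultrafilter.ofComapInfPrincipal_mem hMw
  have hu : Tendsto eval (u : Filter (BoundedRadonMeasure T)) (𝓝 L) := by
    have hmap : u.map eval = w := Ultrafilter.ofComapInfPrincipal_eq_of_map hMw
    rw [Tendsto, ← Ultrafilter.coe_map, hmap]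
    exact hw
  have hlim : ∀ p : BoundedRadonMeasure T → Measure T, (∀ μ A, p μ A ≤ μ.var A) →
      ∃ ν : Measure T, IsFiniteMeasure ν ∧
      (∀ B : Set T, MeasurableSet B → ∀ ε : ℝ≥0∞, 0 < ε →
        ∃ C : Set T, IsCompact C ∧ C ⊆ B ∧ ν (B \ C) < ε) ∧
      ∀ G : Set T, IsOpen G → Tendsto (fun μ => p μ G) u (𝓝 (ν G)) := by
    intro p hp
    refine exists_radon_tendsto_isOpen u p hβ
      (hMu.mono fun μ hμ => (hp μ univ).trans (le_iSup₂ (f := fun μ _ => μ.var univ) μ hμ)) ?_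
    intro G hG ε hε
    obtain ⟨δ, hδ, hδε⟩ := ENNReal.lt_iff_exists_nnreal_btwn.1 hε
    obtain ⟨C, hC, hCG, hCM⟩ := hα G hG δ (by exact_mod_cast hδ)
    refine ⟨C, hC, hCG, hMu.mono fun μ hμ => (hp μ _).trans ((hCM μ hμ).le.trans ?_)⟩
    rw [ENNReal.ofReal_coe_nnreal]
    exact hδε.le
  obtain ⟨ν₁, _, hr₁, ht₁⟩ := hlim pos pos_le_var
  obtain ⟨ν₂, _, hr₂, ht₂⟩ := hlim neg neg_le_var
  refine ⟨ofSub ν₁ ν₂ hr₁ hr₂, tendsto_nhds_unique (tendsto_pi_nhds.2 fun f => ?_) hu⟩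
  have h := (f.2.tendsto_integral ht₁).sub (f.2.tendsto_integral ht₂)
  rw [← integral_eq_of_toSignedMeasure_eq_sub (μ := ofSub ν₁ ν₂ hr₁ hr₂) rfl f.2] at h
  exact h

theorem isCompact_closure_image_eval {M : Set (BoundedRadonMeasure T)}
    (hβ : UniformlyBoundedVar M) : IsCompact (closure (eval '' M)) := by
  set c : ℝ≥0∞ := ⨆ μ ∈ M, μ.var univ
  have hbd : ∀ f : SymmetrizableFun T, ∃ r : ℝ, ∀ μ ∈ M, |eval μ f| ≤ r := by
    intro f
    obtain ⟨g, hg, hfg⟩ := f.2.exists_span_approx one_pos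
    obtain ⟨-, b, hb⟩ := measurable_and_bounded_of_mem_span hg
    have hfb : ∀ x, ‖f.1 x‖ ≤ 1 + |b| := fun x => by
      have h1 := abs_le.1 (hfg x)
      have h2 := abs_le.1 ((hb x).trans (le_abs_self b))
      rw [Real.norm_eq_abs, abs_le]
      constructor <;> linarith [h1.1, h1.2, h2.1, h2.2]
    have hp : ∀ (ν : Measure T) [IsFiniteMeasure ν], ∀ μ ∈ M, (∀ A, ν A ≤ μ.var A) →
        |∫ t, f.1 t ∂ν| ≤ (1 + |b|) * c.toReal := fun ν _ μ hμ hν =>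
      (norm_integral_le_of_norm_le_const (ae_of_all _ hfb)).trans
        (mul_le_mul_of_nonneg_left (ENNReal.toReal_mono hβ.ne ((hν univ).trans
          (le_iSup₂ (f := fun μ _ => μ.var univ) μ hμ))) (by positivity))
    refine ⟨(1 + |b|) * c.toReal + (1 + |b|) * c.toReal, fun μ hμ => ?_⟩
    exact (abs_sub _ _).trans (add_le_add (hp _ μ hμ μ.pos_le_var) (hp _ μ hμ μ.neg_le_var))
  choose r hr using hbd
  refine (isCompact_univ_pi fun f => isCompact_Icc (a := -r f) (b := r f)).closure_of_subset ?_
  rintro _ ⟨μ, hμ, rfl⟩ f -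
  exact abs_le.1 (hr f μ hμ)

end BoundedRadonMeasure

theorem mainTheorem2 {T : Type*} [TopologicalSpace T] [T2Space T] [MeasurableSpace T]
    [BorelSpace T] (M : Set (BoundedRadonMeasure T))
    (hα : BoundedRadonMeasure.LocallyUniformlyTightVar M)
    (hβ : BoundedRadonMeasure.UniformlyBoundedVar M) :
    IsCompact (closure M) ∧ T2Space (closure M) := by
  refine ⟨?_, inferInstance⟩
  -- For an inducing map, the preimage of a set inside the range is compact exactly when the set is.
  rw [BoundedRadonMeasure.isInducing_eval.closure_eq_preimage_closure_image,
    BoundedRadonMeasure.isInducing_eval.isCompact_preimage_iff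
      (BoundedRadonMeasure.closure_image_eval_subset_range hα hβ)]
  exact BoundedRadonMeasure.isCompact_closure_image_eval hβ
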